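/- Let $k,d\ge 0$ be integers, $n=k+d$, let $\Theta$ be an antisymmetric real $n\times n$ matrix, and let $r=(r_1,\dots,r_k,0,\dots,0)\in[0,\infty)^n$ with $r_1,\dots,r_k>0$. Put $\sigma_\Theta(p,q)=e^{-\pi i\langle p,\Theta q\rangle}$ for $p,q\in\mathbb N^n$ (where $0\in\mathbb N$), and let $\mathcal T_r(\mathbb N^n,\sigma_\Theta)$ be the C*-subalgebra of $\mathcal B(\ell^2(\mathbb N^n))$ generated by the isometries $L_p$, $p\in\mathbb N^n$, given by $L_p\delta_q=\sigma_\Theta(p,q)\delta_{p+q}$. Let $\alpha^r$ be the one-parameter automorphism group of $\mathcal T_r(\mathbb N^n,\sigma_\Theta)$ given by $\alpha^r_t=\operatorname{Ad}u_t$ with $u_t\delta_q=e^{i\langle q,r\rangle t}\delta_q$, so that $\alpha^r_t(L_p)=e^{i\langle p,r\rangle t}L_p$. For $\beta\in\mathbb R$, a $\mathrm{KMS}_\beta$ state is a state $\varphi$ of $\mathcal T_r(\mathbb N^n,\sigma_\Theta)$ with $\varphi(AB)=\varphi(B\alpha^r_{i\beta}(A))$ for all $B$ and all $\alpha^r$-analytic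 $A$ (those for which $t\mapsto\alpha^r_t(A)$ extends to an entire function $z\mapsto\alpha^r_z(A)$). Let $\Theta_d$ be the lower right $d\times d$ corner of $\Theta$; it is called nondegenerate if $x=0$ is the only $x\in\mathbb Z^d$ such that $\langle x,\Theta_d y\rangle\in\mathbb Z$ for all $y\in\mathbb Z^d$. If all coordinates of $r$ are strictly positive (so $d=0$), or if $\Theta_d$ is nondegenerate, then for each $\beta>0$ the system $(\mathcal T_r(\mathbb N^n,\sigma_\Theta),\alpha^r)$ has a unique $\mathrm{KMS}_\beta$ state. -/

import Mathlib

open scoped ENNReal Matrix ComplexOrder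

noncomputable section

namespace ToeplitzTorus

/-! ### The Hilbert space `ℓ²(ℕⁿ)` and its weighted permutation isometries -/

/-- The Hilbert space `ℓ²(ℕⁿ)`. -/
abbrev Hil (n : ℕ) : Type := lp (fun _ : Fin n → ℕ => ℂ) 2

/-- The canonical basis vector `δ_q` of `ℓ²(ℕⁿ)`. -/
def delta {n : ℕ} (q : Fin n → ℕ) : Hil n := lp.single 2 q (1 : ℂ)

theorem orthonormal_smul_delta {n : ℕ} (g : (Fin n → ℕ) → (Fin n → ℕ)) (hg : g.Injective)
    (c : (Fin n → ℕ) → Circle) :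
    Orthonormal ℂ (fun q => (c q : ℂ) • (delta (g q) : Hil n)) := by
  classical
  rw [orthonormal_iff_ite]
  intro i j
  rw [inner_smul_left, inner_smul_right]
  unfold delta
  rw [lp.inner_single_left, lp.single_apply]
  by_cases h : i = j
  · subst h
    have hc : (c i : ℂ) * (starRingEnd ℂ) (c i : ℂ) = 1 := by
      rw [Complex.mul_conj, Circle.normSq_coe, Complex.ofReal_one]
    simp [mul_comm, hc]
  · have h' : g i ≠ g j := fun e => h (hg e)
    simp [h, h']

/-- For `g` injective and circle-valued weights `c`, the isometry of `ℓ²(ℕⁿ)` that maps `δ_q` to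
`c(q) δ_{g(q)}`. -/
def weightedIsometry {n : ℕ} (g : (Fin n → ℕ) → (Fin n → ℕ)) (hg : g.Injective)
    (c : (Fin n → ℕ) → Circle) : Hil n →L[ℂ] Hil n :=
  (orthonormal_smul_delta g hg c).orthogonalFamily.linearIsometry.toContinuousLinearMap

theorem weightedIsometry_delta {n : ℕ} (g : (Fin n → ℕ) → (Fin n → ℕ)) (hg : g.Injective)
    (c : (Fin n → ℕ) → Circle) (q : Fin n → ℕ) :
    weightedIsometry g hg c (delta q) = (c q : ℂ) • delta (g q) := by
  unfold weightedIsometry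
  rw [LinearIsometry.coe_toContinuousLinearMap]
  conv_lhs => rw [delta]
  rw [OrthogonalFamily.linearIsometry_apply_single]
  simp

/-- Bounded operators that agree on the canonical basis are equal. -/
theorem clm_ext {n : ℕ} {S T : Hil n →L[ℂ] Hil n} (h : ∀ q, S (delta q) = T (delta q)) :
    S = T := by
  ext1 f
  have hf := lp.hasSum_single (E := fun _ : Fin n → ℕ => ℂ) (p := 2) (by simp) f
  have key : ∀ (q : Fin n → ℕ) (a : ℂ), (lp.single 2 q a : Hil n) = a • delta q := by
    intro q a
    rw [delta, ← lp.single_smul]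
    simp
  have h1 := hf.mapL S
  have h2 := hf.mapL T
  refine h1.unique ?_
  convert h2 using 2 with q
  rw [key, map_smul, map_smul, h q]

/-! ### The Toeplitz noncommutative torus -/

/-- The left regular `σ`-representation of `ℕⁿ`: `L_p δ_q = σ(p,q) δ_{p+q}`. -/
def leftReg {n : ℕ} (σ : (Fin n → ℕ) → (Fin n → ℕ) → Circle) (p : Fin n → ℕ) :
    Hil n →L[ℂ] Hil n :=
  weightedIsometry (fun q => p + q) (add_right_injective p) (σ p)

/-- The reduced twisted semigroup C*-algebra `𝒯_r(ℕⁿ,σ)`: the norm closed *-subalgebra of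
`B(ℓ²(ℕⁿ))` generated by the operators `L_p`, `p ∈ ℕⁿ`. -/
def toeplitz {n : ℕ} (σ : (Fin n → ℕ) → (Fin n → ℕ) → Circle) :
    StarSubalgebra ℂ (Hil n →L[ℂ] Hil n) :=
  (StarAlgebra.adjoin ℂ (Set.range (leftReg σ))).topologicalClosure

instance toeplitz_isClosed {n : ℕ} (σ : (Fin n → ℕ) → (Fin n → ℕ) → Circle) :
    IsClosed (toeplitz σ : Set (Hil n →L[ℂ] Hil n)) :=
  StarSubalgebra.isClosed_topologicalClosure _

/-- The cocycle `σ_Θ(p,q) = exp(-π i ⟨p, Θ q⟩)` of a real matrix `Θ`. -/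
def cocycle {n : ℕ} (Θ : Matrix (Fin n) (Fin n) ℝ) (p q : Fin n → ℕ) : Circle :=
  Circle.exp (-(Real.pi * ((fun i => (p i : ℝ)) ⬝ᵥ (Θ *ᵥ fun j => (q j : ℝ)))))

/-- An antisymmetric real matrix `D` is nondegenerate if `x = 0` is the only `x ∈ ℤᵈ` such that
`⟨x, D y⟩ ∈ ℤ` for every `y ∈ ℤᵈ`. -/
def Nondegenerate {d : ℕ} (D : Matrix (Fin d) (Fin d) ℝ) : Prop :=
  ∀ x : Fin d → ℤ,
    (∀ y : Fin d → ℤ, ∃ m : ℤ, (fun i => (x i : ℝ)) ⬝ᵥ (D *ᵥ fun j => (y j : ℝ)) = m) → x = 0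

/-! ### The dynamics -/

/-- The diagonal operator `u_t δ_q = exp(i ⟨q,r⟩ t) δ_q`. -/
def diagOp {n : ℕ} (r : Fin n → ℝ) (t : ℝ) : Hil n →L[ℂ] Hil n :=
  weightedIsometry id Function.injective_id
    (fun q => Circle.exp (((fun i => (q i : ℝ)) ⬝ᵥ r) * t))

theorem diagOp_add {n : ℕ} (r : Fin n → ℝ) (s t : ℝ) :
    diagOp r (s + t) = diagOp r s * diagOp r t := by
  refine clm_ext fun q => ?_
  simp only [diagOp, mul_apply_eq_comp, weightedIsometry_delta, map_smul, smul_smul,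
    id]
  rw [mul_add, Circle.exp_add, Circle.coe_mul, mul_comm]

theorem diagOp_zero {n : ℕ} (r : Fin n → ℝ) : diagOp r 0 = 1 := by
  refine clm_ext fun q => ?_
  simp [diagOp, weightedIsometry_delta]

theorem star_diagOp {n : ℕ} (r : Fin n → ℝ) (t : ℝ) : star (diagOp r t) = diagOp r (-t) := by
  have h1 : star (diagOp r t) * diagOp r t = 1 := by
    rw [ContinuousLinearMap.star_eq_adjoint]
    refine (ContinuousLinearMap.norm_map_iff_adjoint_comp_self _).1 fun x => ?_
    exact LinearIsometry.norm_map _ x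
  have h2 : diagOp r t * diagOp r (-t) = 1 := by
    rw [← diagOp_add, add_neg_cancel, diagOp_zero]
  exact left_inv_eq_right_inv h1 h2

/-- The one-parameter unitary group `t ↦ u_t` on `ℓ²(ℕⁿ)`. -/
def unitaryGroup {n : ℕ} (r : Fin n → ℝ) :
    Multiplicative ℝ →* unitary (Hil n →L[ℂ] Hil n) where
  toFun t := ⟨diagOp r t.toAdd, by
    rw [Unitary.mem_iff, star_diagOp, ← diagOp_add, ← diagOp_add]
    simp [diagOp_zero]⟩
  map_one' := Subtype.ext (diagOp_zero r)
  map_mul' s t := Subtype.ext (diagOp_add r s.toAdd t.toAdd)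

/-- Conjugation by `u_t`, a one-parameter automorphism group of `B(ℓ²(ℕⁿ))`. -/
def conjGroup {n : ℕ} (r : Fin n → ℝ) :
    Multiplicative ℝ →* ((Hil n →L[ℂ] Hil n) ≃⋆ₐ[ℂ] (Hil n →L[ℂ] Hil n)) :=
  (Unitary.conjStarAlgAut ℂ (Hil n →L[ℂ] Hil n)).comp (unitaryGroup r)

theorem conjGroup_apply {n : ℕ} (r : Fin n → ℝ) (t : Multiplicative ℝ)
    (X : Hil n →L[ℂ] Hil n) :
    conjGroup r t X = diagOp r t.toAdd * X * star (diagOp r t.toAdd) := rfl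

/-- `u_t L_p u_t* = exp(i ⟨p,r⟩ t) L_p`. -/
theorem conjGroup_leftReg {n : ℕ} (r : Fin n → ℝ) (t : Multiplicative ℝ)
    (σ : (Fin n → ℕ) → (Fin n → ℕ) → Circle) (p : Fin n → ℕ) :
    conjGroup r t (leftReg σ p)
      = (Circle.exp (((fun i => (p i : ℝ)) ⬝ᵥ r) * t.toAdd) : ℂ) • leftReg σ p := by
  rw [conjGroup_apply, star_diagOp]
  refine clm_ext fun q => ?_
  simp only [diagOp, leftReg, mul_apply_eq_comp, smul_apply,
    weightedIsometry_delta, map_smul, smul_smul, id]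
  congr 1
  have h : ((fun i => (((p + q) i : ℕ) : ℝ)) ⬝ᵥ r)
      = ((fun i => (p i : ℝ)) ⬝ᵥ r) + ((fun i => (q i : ℝ)) ⬝ᵥ r) := by
    rw [← add_dotProduct]
    congr 1
    ext i
    simp
  rw [h, add_mul, Circle.exp_add, mul_neg, Circle.exp_neg, Circle.coe_mul, Circle.coe_inv]
  have h0 := Circle.coe_ne_zero (Circle.exp (((fun i => (q i : ℝ)) ⬝ᵥ r) * t.toAdd))
  field_simp

theorem conjGroup_mem {n : ℕ} (r : Fin n → ℝ) (σ : (Fin n → ℕ) → (Fin n → ℕ) → Circle)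
    (t : Multiplicative ℝ) {X : Hil n →L[ℂ] Hil n} (hX : X ∈ toeplitz σ) :
    conjGroup r t X ∈ toeplitz σ := by
  have hcont : Continuous fun X : Hil n →L[ℂ] Hil n => conjGroup r t X := by
    simp only [conjGroup_apply]
    fun_prop
  refine map_mem_closure
    (s := ((StarAlgebra.adjoin ℂ (Set.range (leftReg σ)) :
      StarSubalgebra ℂ (Hil n →L[ℂ] Hil n)) : Set (Hil n →L[ℂ] Hil n)))
    (t := ((StarAlgebra.adjoin ℂ (Set.range (leftReg σ)) :
      StarSubalgebra ℂ (Hil n →L[ℂ] Hil n)) : Set (Hil n →L[ℂ] Hil n)))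
    hcont hX ?_
  intro Y hY
  have hle : StarAlgebra.adjoin ℂ (Set.range (leftReg σ)) ≤
      (StarAlgebra.adjoin ℂ (Set.range (leftReg σ))).comap
        (conjGroup r t : (Hil n →L[ℂ] Hil n) →⋆ₐ[ℂ] (Hil n →L[ℂ] Hil n)) := by
    refine StarAlgebra.adjoin_le ?_
    rintro _ ⟨p, rfl⟩
    change conjGroup r t (leftReg σ p) ∈ StarAlgebra.adjoin ℂ (Set.range (leftReg σ))
    rw [conjGroup_leftReg]
    exact SMulMemClass.smul_mem _ (StarAlgebra.subset_adjoin ℂ _ ⟨p, rfl⟩)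
  exact hle hY

/-- The one-parameter automorphism group `α^r` of `𝒯_r(ℕⁿ,σ)`, the restriction of conjugation by
the unitaries `u_t`; it satisfies `α^r_t(L_p) = exp(i ⟨p,r⟩ t) L_p`. -/
def dynamics {n : ℕ} (σ : (Fin n → ℕ) → (Fin n → ℕ) → Circle) (r : Fin n → ℝ) :
    Multiplicative ℝ →* (toeplitz σ ≃⋆ₐ[ℂ] toeplitz σ) where
  toFun t :=
    { toFun := fun X => ⟨conjGroup r t X, conjGroup_mem r σ t X.2⟩
      invFun := fun X => ⟨conjGroup r t⁻¹ X, conjGroup_mem r σ t⁻¹ X.2⟩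
      left_inv := fun X => Subtype.ext (by
        change (conjGroup r t⁻¹ * conjGroup r t) (X : Hil n →L[ℂ] Hil n) = X
        rw [← map_mul, inv_mul_cancel, map_one]; rfl)
      right_inv := fun X => Subtype.ext (by
        change (conjGroup r t * conjGroup r t⁻¹) (X : Hil n →L[ℂ] Hil n) = X
        rw [← map_mul, mul_inv_cancel, map_one]; rfl)
      map_mul' := fun X Y => Subtype.ext (map_mul (conjGroup r t) _ _)
      map_add' := fun X Y => Subtype.ext (map_add (conjGroup r t) _ _)
      map_star' := fun X => Subtype.ext (map_star (conjGroup r t) _)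
      map_smul' := fun c X => Subtype.ext (map_smul (conjGroup r t) c _) }
  map_one' := by
    ext1 X
    exact Subtype.ext (by
      change conjGroup r 1 (X : Hil n →L[ℂ] Hil n) = X
      rw [map_one]; rfl)
  map_mul' s t := by
    ext1 X
    exact Subtype.ext (by
      change conjGroup r (s * t) (X : Hil n →L[ℂ] Hil n) = (conjGroup r s * conjGroup r t) X
      rw [map_mul])

/-! ### States and the KMS condition -/

/-- A state of a unital C*-algebra: a positive linear functional of value `1` at the unit. -/
structure IsState {A : Type*} [CStarAlgebra A] (φ : A →L[ℂ] ℂ) : Prop where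
  nonneg : ∀ a : A, 0 ≤ φ (star a * a)
  map_one : φ 1 = 1

/-- `F : ℂ → A` is the entire extension `z ↦ α_z(a)` of the orbit `t ↦ α_t(a)`. The element `a` is
`α`-analytic precisely when such an `F` exists, and then `F` is unique. -/
structure IsAnalyticExtension {A : Type*} [CStarAlgebra A]
    (α : Multiplicative ℝ →* (A ≃⋆ₐ[ℂ] A)) (a : A) (F : ℂ → A) : Prop where
  differentiable : Differentiable ℂ F
  apply_real : ∀ t : ℝ, F (t : ℂ) = α (Multiplicative.ofAdd t) a

/-- `φ` is a `KMS_β` state for `α`: it is a state and `φ(a b) = φ(b α_{iβ}(a))` for every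
`α`-analytic `a` and every `b`. -/
structure IsKMSState {A : Type*} [CStarAlgebra A]
    (α : Multiplicative ℝ →* (A ≃⋆ₐ[ℂ] A)) (β : ℝ) (φ : A →L[ℂ] ℂ) : Prop where
  isState : IsState φ
  kms : ∀ (a b : A) (F : ℂ → A), IsAnalyticExtension α a F →
    φ (a * b) = φ (b * F (Complex.I * β))

end ToeplitzTorus

end

open scoped ENNReal Matrix ComplexOrder

noncomputable section

namespace ToeplitzTorus

variable {n : ℕ}

/-! Every product of generators and their adjoints reduces to a multiple of some `L_p L_q*`, so
these monomials span a dense subspace and a KMS state is determined by its values on them.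

Uniqueness (`kms_monomial`): moving factors cyclically gives `e^{-β⟨p,r⟩}` for `p = q`, and for `p ≠
q` reduces the value to one at `L_a L_b*` with `a ≠ b` of disjoint supports. Such `L_a` and `L_b*`
commute up to a phase, while the KMS condition exchanges them at the cost of a positive factor that
differs from 1 unless the weights vanish; so the value is 0 unless `a` and `b` both have weight 0
(`kms_monomial_eq_zero_of_weight_ne`). For `x` of weight 0 the range projection of `L_x` has value
1, so the state treats `L_x` as a unitary and is invariant under conjugation by it. A nonzero value
then forces `⟨a - b, Θ x⟩` to be an integer (`kms_monomial_phase`, `exists_int_of_phase_eq`), which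
nondegeneracy excludes.

Existence: for strictly positive weights the Gibbs functional works, and a weak* limit of Gibbs
functionals handles vanishing weights (`exists_isEquilibrium`). The limit satisfies the KMS relation
on monomials; the identity theorem extends it to all analytic elements (`exists_kms`). -/

/-! ### The pairing and the cocycle -/

/-- The weight `⟨p, r⟩`. -/
def weight (r : Fin n → ℝ) (p : Fin n → ℕ) : ℝ := (fun i => (p i : ℝ)) ⬝ᵥ r

theorem weight_add (r : Fin n → ℝ) (p q : Fin n → ℕ) :
    weight r (p + q) = weight r p + weight r q := by
  simp [weight, dotProduct, add_mul, Finset.sum_add_distrib]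

theorem eq_zero_of_weight_eq_zero {r : Fin n → ℝ} (hr : ∀ i, 0 ≤ r i) {p : Fin n → ℕ}
    (hp : weight r p = 0) {i : Fin n} (hi : 0 < r i) : p i = 0 := by
  unfold weight dotProduct at hp
  have h := (Finset.sum_eq_zero_iff_of_nonneg
    (fun j _ => mul_nonneg (Nat.cast_nonneg (p j)) (hr j))).1 hp i (Finset.mem_univ i)
  rcases mul_eq_zero.1 h with h | h
  · exact_mod_cast h
  · exact absurd h hi.ne'

theorem cocycle_add_left (Θ : Matrix (Fin n) (Fin n) ℝ) (p q s : Fin n → ℕ) :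
    cocycle Θ (p + q) s = cocycle Θ p s * cocycle Θ q s := by
  have h : (fun i => (((p + q) i : ℕ) : ℝ)) = (fun i => (p i : ℝ)) + fun i => (q i : ℝ) := by
    ext i; simp
  rw [cocycle, cocycle, cocycle, h, add_dotProduct, mul_add, neg_add, Circle.exp_add]

theorem cocycle_add_right (Θ : Matrix (Fin n) (Fin n) ℝ) (p q s : Fin n → ℕ) :
    cocycle Θ p (q + s) = cocycle Θ p q * cocycle Θ p s := by
  have h : (fun i => (((q + s) i : ℕ) : ℝ)) = (fun i => (q i : ℝ)) + fun i => (s i : ℝ) := by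
    ext i; simp
  rw [cocycle, cocycle, cocycle, h, Matrix.mulVec_add, dotProduct_add, mul_add, neg_add,
    Circle.exp_add]

theorem cocycle_zero_left (Θ : Matrix (Fin n) (Fin n) ℝ) (p : Fin n → ℕ) :
    cocycle Θ 0 p = 1 := by
  simpa using cocycle_add_left Θ 0 0 p

theorem star_circle_mul_self (c : Circle) : star (c : ℂ) * c = 1 := by
  rw [Complex.star_def, ← Circle.coe_inv_eq_conj, ← Circle.coe_mul, inv_mul_cancel, Circle.coe_one]

/-! ### The relations between the generating isometries -/

theorem inner_delta_left (q : Fin n → ℕ) (x : Hil n) : inner ℂ (delta q) x = x q := by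
  rw [delta, lp.inner_single_left]; simp

theorem ext_inner_delta {x y : Hil n} (h : ∀ q, inner ℂ (delta q) x = inner ℂ (delta q) y) :
    x = y := by
  ext q
  simpa [inner_delta_left] using h q

theorem norm_delta (q : Fin n → ℕ) : ‖(delta q : Hil n)‖ = 1 := by
  rw [delta, lp.norm_single (by simp)]; simp

theorem delta_apply (p q : Fin n → ℕ) : (delta p : Hil n) q = if q = p then 1 else 0 := by
  classical
  rw [delta, lp.single_apply]
  by_cases h : q = p <;> simp [h]

variable (σ : (Fin n → ℕ) → (Fin n → ℕ) → Circle)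

theorem leftReg_delta (p q : Fin n → ℕ) :
    leftReg σ p (delta q) = (σ p q : ℂ) • delta (p + q) :=
  weightedIsometry_delta _ _ _ _

theorem star_leftReg_mul_self (p : Fin n → ℕ) : star (leftReg σ p) * leftReg σ p = 1 := by
  rw [ContinuousLinearMap.star_eq_adjoint]
  refine (ContinuousLinearMap.norm_map_iff_adjoint_comp_self _).1 fun x => ?_
  exact LinearIsometry.norm_map _ x

theorem star_leftReg_delta_add (p q : Fin n → ℕ) :
    star (leftReg σ p) (delta (p + q)) = star (σ p q : ℂ) • delta q := by
  have h : (delta (p + q) : Hil n) = star (σ p q : ℂ) • leftReg σ p (delta q) := by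
    rw [leftReg_delta, smul_smul, star_circle_mul_self, one_smul]
  rw [h, map_smul]
  congr 1
  exact DFunLike.congr_fun (star_leftReg_mul_self σ p) (delta q)

theorem star_leftReg_delta_of_not_le {p q : Fin n → ℕ} (h : ¬ p ≤ q) :
    star (leftReg σ p) (delta q) = 0 := by
  refine ext_inner_delta fun s => ?_
  rw [ContinuousLinearMap.star_eq_adjoint, ContinuousLinearMap.adjoint_inner_right, leftReg_delta,
    inner_smul_left, inner_delta_left, delta_apply, if_neg, mul_zero, inner_zero_right]
  rintro rfl
  exact h (fun i => Nat.le_add_right _ _)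

variable (Θ : Matrix (Fin n) (Fin n) ℝ)

theorem leftReg_mul (p q : Fin n → ℕ) :
    leftReg (cocycle Θ) p * leftReg (cocycle Θ) q
      = (cocycle Θ p q : ℂ) • leftReg (cocycle Θ) (p + q) := by
  refine clm_ext fun s => ?_
  rw [mul_apply_eq_comp, smul_apply, leftReg_delta, map_smul, leftReg_delta, leftReg_delta,
    smul_smul, smul_smul, cocycle_add_right, cocycle_add_left, add_assoc]
  push_cast
  congr 1
  ring

theorem leftReg_zero : leftReg (cocycle Θ) (0 : Fin n → ℕ) = 1 := by
  refine clm_ext fun s => ?_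
  rw [leftReg_delta, cocycle_zero_left]
  simp

/-- Isometries with disjoint supports doubly commute up to a phase. -/
theorem star_leftReg_mul_leftReg_of_disjoint {p q : Fin n → ℕ} (h : ∀ i, p i = 0 ∨ q i = 0) :
    star (leftReg (cocycle Θ) q) * leftReg (cocycle Θ) p
      = ((cocycle Θ p q * (cocycle Θ q p)⁻¹ : Circle) : ℂ) •
        (leftReg (cocycle Θ) p * star (leftReg (cocycle Θ) q)) := by
  refine clm_ext fun s => ?_
  rw [mul_apply_eq_comp, smul_apply, mul_apply_eq_comp, leftReg_delta, map_smul]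
  by_cases hs : q ≤ s
  · obtain ⟨u, rfl⟩ := exists_add_of_le hs
    rw [star_leftReg_delta_add, add_left_comm, star_leftReg_delta_add, map_smul, leftReg_delta,
      smul_smul, smul_smul, smul_smul, cocycle_add_right, cocycle_add_right]
    congr 1
    simp only [Complex.star_def, ← Circle.coe_inv_eq_conj, ← Circle.coe_mul]
    congr 1
    rw [mul_inv]
    ac_rfl
  -- Where `q` is nonzero `p` is zero, so adding `p` cannot help to dominate `q`: both sides kill
  -- `δ_s`.
  · have hs' : ¬ q ≤ p + s := by
      intro hq
      refine hs fun i => ?_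
      have := hq i
      rcases h i with h | h <;> simp_all
    rw [star_leftReg_delta_of_not_le _ hs, star_leftReg_delta_of_not_le _ hs', smul_zero, map_zero,
      smul_zero]

/-- Split the common part `p ⊓ q` off both isometries; it cancels because `L_{p ⊓ q}` is an
isometry, and the truncated differences that remain have disjoint supports. -/
theorem star_leftReg_mul_leftReg (p q : Fin n → ℕ) :
    ∃ c : Circle, star (leftReg (cocycle Θ) q) * leftReg (cocycle Θ) p
      = (c : ℂ) • (star (leftReg (cocycle Θ) (q - p)) * leftReg (cocycle Θ) (p - q)) := by
  have hp : p ⊓ q + (p - q) = p := by ext i; simp; omega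
  have hq : p ⊓ q + (q - p) = q := by ext i; simp; omega
  have key : ∀ a m : Fin n → ℕ, leftReg (cocycle Θ) (m + a)
      = (((cocycle Θ m a)⁻¹ : Circle) : ℂ) • (leftReg (cocycle Θ) m * leftReg (cocycle Θ) a) := by
    intro a m
    rw [leftReg_mul, smul_smul, ← Circle.coe_mul, inv_mul_cancel, Circle.coe_one, one_smul]
  refine ⟨cocycle Θ (p ⊓ q) (q - p) * (cocycle Θ (p ⊓ q) (p - q))⁻¹, ?_⟩
  have h1 := key (p - q) (p ⊓ q)
  have h2 := key (q - p) (p ⊓ q)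
  rw [hp] at h1
  rw [hq] at h2
  rw [h1, h2, star_smul, star_mul, smul_mul_smul_comm, mul_assoc,
    ← mul_assoc (star (leftReg _ (p ⊓ q))), star_leftReg_mul_self, one_mul]
  congr 1
  rw [Complex.star_def, ← Circle.coe_inv_eq_conj, inv_inv, Circle.coe_mul]

theorem disjoint_sub_sub (p q : Fin n → ℕ) (i : Fin n) : (p - q) i = 0 ∨ (q - p) i = 0 := by
  simp only [Pi.sub_apply]; omega

/-! ### The linear span of the operators `L_p L_q*` -/

/-- The linear span of the operators `L_p L_q*`. -/
def monomialSpan : Submodule ℂ (Hil n →L[ℂ] Hil n) :=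
  Submodule.span ℂ (Set.range fun x : (Fin n → ℕ) × (Fin n → ℕ) =>
    leftReg (cocycle Θ) x.1 * star (leftReg (cocycle Θ) x.2))

theorem monomial_mem (p q : Fin n → ℕ) :
    leftReg (cocycle Θ) p * star (leftReg (cocycle Θ) q) ∈ monomialSpan Θ :=
  Submodule.subset_span ⟨(p, q), rfl⟩

/-- Normal ordering: cancel the common part in the middle `L_q* L_s`, then commute the disjoint
remainders past each other. -/
theorem monomial_mul_mem (p q s t : Fin n → ℕ) :
    leftReg (cocycle Θ) p * star (leftReg (cocycle Θ) q) *
      (leftReg (cocycle Θ) s * star (leftReg (cocycle Θ) t)) ∈ monomialSpan Θ := by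
  obtain ⟨c, hc⟩ := star_leftReg_mul_leftReg Θ s q
  rw [star_leftReg_mul_leftReg_of_disjoint Θ (disjoint_sub_sub s q)] at hc
  have : leftReg (cocycle Θ) p * star (leftReg (cocycle Θ) q) *
      (leftReg (cocycle Θ) s * star (leftReg (cocycle Θ) t))
      = leftReg (cocycle Θ) p * (star (leftReg (cocycle Θ) q) * leftReg (cocycle Θ) s) *
        star (leftReg (cocycle Θ) t) := by noncomm_ring
  rw [this, hc, smul_smul, mul_smul_comm, smul_mul_assoc]
  refine Submodule.smul_mem _ _ ?_
  rw [← mul_assoc, mul_assoc (_ * _), ← star_mul, leftReg_mul, leftReg_mul, star_smul,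
    smul_mul_smul_comm]
  exact Submodule.smul_mem _ _ (monomial_mem Θ _ _)

theorem adjoin_le_monomialSpan {X : Hil n →L[ℂ] Hil n}
    (hX : X ∈ StarAlgebra.adjoin ℂ (Set.range (leftReg (cocycle Θ)))) : X ∈ monomialSpan Θ := by
  induction hX using StarAlgebra.adjoin_induction with
  | mem x hx =>
    obtain ⟨p, rfl⟩ := hx
    simpa [leftReg_zero] using monomial_mem Θ p 0
  | algebraMap c =>
    rw [Algebra.algebraMap_eq_smul_one]
    refine Submodule.smul_mem _ _ ?_
    simpa [leftReg_zero] using monomial_mem Θ 0 0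
  | add x y _ _ hx hy => exact add_mem hx hy
  | mul x y _ _ hx hy =>
    have hm : monomialSpan Θ * monomialSpan Θ ≤ monomialSpan Θ := by
      rw [monomialSpan, Submodule.span_mul_span, Submodule.span_le]
      rintro _ ⟨_, ⟨⟨p, q⟩, rfl⟩, _, ⟨⟨s, t⟩, rfl⟩, rfl⟩
      exact monomial_mul_mem Θ p q s t
    exact hm (Submodule.mul_mem_mul hx hy)
  | star x hmem hx =>
    clear hmem
    induction hx using Submodule.span_induction with
    | mem x hx =>
      obtain ⟨⟨p, q⟩, rfl⟩ := hx
      rw [star_mul, star_star]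
      exact monomial_mem Θ q p
    | zero => simp
    | add x y _ _ hx hy => rw [star_add]; exact add_mem hx hy
    | smul c x _ hx => rw [star_smul]; exact Submodule.smul_mem _ _ hx

/-- The isometry `L_p` as an element of the Toeplitz algebra. -/
def gen (p : Fin n → ℕ) : toeplitz (cocycle Θ) :=
  ⟨leftReg (cocycle Θ) p,
    StarSubalgebra.le_topologicalClosure _ (StarAlgebra.subset_adjoin ℂ _ ⟨p, rfl⟩)⟩

/-- A closed subspace of the Toeplitz algebra that contains all `L_p L_q*` is everything. -/
theorem mem_of_monomial_mem (K : Submodule ℂ (toeplitz (cocycle Θ)))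
    (hK : IsClosed (K : Set (toeplitz (cocycle Θ))))
    (h : ∀ p q, gen Θ p * star (gen Θ q) ∈ K) (b : toeplitz (cocycle Θ)) : b ∈ K := by
  have hcl : IsClosed ((↑) '' (K : Set (toeplitz (cocycle Θ))) : Set (Hil n →L[ℂ] Hil n)) :=
    (toeplitz_isClosed (cocycle Θ)).isClosedEmbedding_subtypeVal.isClosedMap _ hK
  have hspan : monomialSpan Θ ≤ K.map (toeplitz (cocycle Θ)).subtype.toLinearMap := by
    rw [monomialSpan, Submodule.span_le]
    rintro _ ⟨⟨p, q⟩, rfl⟩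
    exact ⟨_, h p q, rfl⟩
  have hsub : ((StarAlgebra.adjoin ℂ (Set.range (leftReg (cocycle Θ))) :
      StarSubalgebra ℂ (Hil n →L[ℂ] Hil n)) : Set (Hil n →L[ℂ] Hil n)) ⊆
      (↑) '' (K : Set (toeplitz (cocycle Θ))) := by
    intro X hX
    obtain ⟨y, hy, rfl⟩ := hspan (adjoin_le_monomialSpan Θ hX)
    exact ⟨y, hy, rfl⟩
  obtain ⟨y, hy, hyb⟩ := closure_minimal hsub hcl b.2
  rwa [← Subtype.ext hyb]

/-! ### States and KMS states on eigenvectors of the dynamics -/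

section Abstract

variable {A : Type*} [CStarAlgebra A]

theorem isAnalyticExtension_of_eigen {α : Multiplicative ℝ →* (A ≃⋆ₐ[ℂ] A)} {a : A} {l : ℝ}
    (h : ∀ t : ℝ, α (Multiplicative.ofAdd t) a = Complex.exp (l * t * Complex.I) • a) :
    IsAnalyticExtension α a (fun z => Complex.exp (l * z * Complex.I) • a) where
  differentiable := by fun_prop
  apply_real t := (h t).symm

/-- The entire extension of the orbit is `z ↦ e^{ilz} a`, whose value at `iβ` is `e^{-βl} a`. -/
theorem IsKMSState.apply_eigen_mul {α : Multiplicative ℝ →* (A ≃⋆ₐ[ℂ] A)} {β : ℝ}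
    {φ : A →L[ℂ] ℂ} (hφ : IsKMSState α β φ) {a : A} {l : ℝ}
    (h : ∀ t : ℝ, α (Multiplicative.ofAdd t) a = Complex.exp (l * t * Complex.I) • a) (b : A) :
    φ (a * b) = (Real.exp (-(β * l)) : ℂ) * φ (b * a) := by
  rw [hφ.kms a b _ (isAnalyticExtension_of_eigen h), mul_smul_comm, map_smul, smul_eq_mul]
  congr 1
  push_cast
  congr 1
  linear_combination (l * β : ℂ) * Complex.I_sq

/-- A state kills `y* x` and `x* y` as soon as it kills `x* x`. -/
theorem IsState.apply_star_mul_eq_zero {φ : A →L[ℂ] ℂ} (hφ : IsState φ) {x : A}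
    (hx : φ (star x * x) = 0) (y : A) :
    φ (star y * x) = 0 ∧ φ (star x * y) = 0 := by
  -- Positivity at `y + s x`; the term quadratic in `s` drops out because `φ` kills `x* x`.
  have key : ∀ s : ℂ,
      0 ≤ φ (star y * y) + s * φ (star y * x) + star s * φ (star x * y) := by
    intro s
    have h := hφ.nonneg (y + s • x)
    have e : star (y + s • x) * (y + s • x) = star y * y + s • (star y * x)
        + star s • (star x * y) + (star s * s) • (star x * x) := by
      simp only [star_add, star_smul, add_mul, mul_add, smul_mul_assoc, mul_smul_comm]
      module
    rw [e] at h
    simpa [hx] using h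
  have him : (φ (star y * y)).im = 0 := (Complex.nonneg_iff.1 (hφ.nonneg y)).2.symm
  set c := φ (star y * y)
  set u := φ (star y * x)
  set v := φ (star x * y)
  -- An affine function bounded below on the line has slope 0. Real and imaginary `s` give the
  -- real-part identities; reality at `s = 1` and `s = i` gives the other two.
  have hlin : ∀ (b m : ℝ), (∀ t : ℝ, 0 ≤ b + t * m) → m = 0 := by
    intro b m h
    by_contra hm
    have := h (-(b + 1) / m)
    rw [div_mul_cancel₀ _ hm] at this
    linarith
  have r1 : u.re + v.re = 0 := hlin c.re _ fun t => by
    have := (Complex.nonneg_iff.1 (key t)).1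
    simp at this
    linarith
  have r2 : v.im - u.im = 0 := hlin c.re _ fun t => by
    have := (Complex.nonneg_iff.1 (key (t * Complex.I))).1
    simp at this
    linarith
  have i1 : u.im + v.im = 0 := by
    have := (Complex.nonneg_iff.1 (key 1)).2
    simp [him] at this
    linarith
  have i2 : u.re - v.re = 0 := by
    have := (Complex.nonneg_iff.1 (key Complex.I)).2
    simp [him] at this
    linarith
  constructor <;> apply Complex.ext <;> simp <;> linarith

/-- A state that takes the value `1` at the range projection `v v*` of an isometry does not see
this projection. -/
theorem IsState.apply_mul_range_projection {φ : A →L[ℂ] ℂ} (hφ : IsState φ) {v : A}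
    (hv : star v * v = 1) (h1 : φ (v * star v) = 1) (y : A) :
    φ (y * (v * star v)) = φ y ∧ φ ((v * star v) * y) = φ y := by
  have hs : star (1 - v * star v) = 1 - v * star v := by simp
  have hp : star (1 - v * star v) * (1 - v * star v) = 1 - v * star v := by
    have : v * star v * (v * star v) = v * (star v * v) * star v := by noncomm_ring
    rw [hs, mul_sub, sub_mul, sub_mul, this, hv]
    simp
  have hx : φ (star (1 - v * star v) * (1 - v * star v)) = 0 := by
    rw [hp, map_sub, hφ.map_one, h1, sub_self]
  constructor
  · have := (hφ.apply_star_mul_eq_zero hx (star y)).1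
    rw [star_star, mul_sub, mul_one, map_sub, sub_eq_zero] at this
    exact this.symm
  · have := (hφ.apply_star_mul_eq_zero hx y).2
    rw [hs, sub_mul, one_mul, map_sub, sub_eq_zero] at this
    exact this.symm

end Abstract

/-! ### Relations in the Toeplitz algebra -/

section Relations

variable (Θ : Matrix (Fin n) (Fin n) ℝ)

theorem gen_mul (p q : Fin n → ℕ) :
    gen Θ p * gen Θ q = (cocycle Θ p q : ℂ) • gen Θ (p + q) :=
  Subtype.ext (leftReg_mul Θ p q)

theorem gen_mul_comm (p q : Fin n → ℕ) :
    gen Θ p * gen Θ q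
      = ((cocycle Θ p q * (cocycle Θ q p)⁻¹ : Circle) : ℂ) • (gen Θ q * gen Θ p) := by
  rw [gen_mul, gen_mul, smul_smul, ← Circle.coe_mul, inv_mul_cancel_right, add_comm]

theorem star_gen_mul_self (p : Fin n → ℕ) : star (gen Θ p) * gen Θ p = 1 :=
  Subtype.ext (star_leftReg_mul_self _ p)

theorem star_gen_mul_gen_of_disjoint {p q : Fin n → ℕ} (h : ∀ i, p i = 0 ∨ q i = 0) :
    star (gen Θ q) * gen Θ p = ((cocycle Θ p q * (cocycle Θ q p)⁻¹ : Circle) : ℂ) •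
      (gen Θ p * star (gen Θ q)) :=
  Subtype.ext (star_leftReg_mul_leftReg_of_disjoint Θ h)

theorem star_gen_mul_gen (p q : Fin n → ℕ) :
    ∃ c : Circle, star (gen Θ q) * gen Θ p
      = (c : ℂ) • (star (gen Θ (q - p)) * gen Θ (p - q)) := by
  obtain ⟨c, hc⟩ := star_leftReg_mul_leftReg Θ p q
  exact ⟨c, Subtype.ext hc⟩

theorem dynamics_gen (r : Fin n → ℝ) (p : Fin n → ℕ) (t : ℝ) :
    dynamics (cocycle Θ) r (Multiplicative.ofAdd t) (gen Θ p)
      = Complex.exp (weight r p * t * Complex.I) • gen Θ p := by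
  have h := conjGroup_leftReg r (Multiplicative.ofAdd t) (cocycle Θ) p
  rw [Circle.coe_exp] at h
  push_cast at h
  exact Subtype.ext h

theorem dynamics_star_gen (r : Fin n → ℝ) (p : Fin n → ℕ) (t : ℝ) :
    dynamics (cocycle Θ) r (Multiplicative.ofAdd t) (star (gen Θ p))
      = Complex.exp ((-weight r p : ℝ) * t * Complex.I) • star (gen Θ p) := by
  rw [map_star, dynamics_gen, star_smul, Complex.star_def, ← Complex.exp_conj]
  simp

theorem dynamics_monomial (r : Fin n → ℝ) (p q : Fin n → ℕ) (t : ℝ) :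
    dynamics (cocycle Θ) r (Multiplicative.ofAdd t) (gen Θ p * star (gen Θ q))
      = Complex.exp ((weight r p - weight r q : ℝ) * t * Complex.I) •
        (gen Θ p * star (gen Θ q)) := by
  rw [map_mul, dynamics_gen, dynamics_star_gen, smul_mul_smul_comm, ← Complex.exp_add]
  congr 2
  push_cast
  ring

/-! ### Uniqueness -/

variable {Θ} {r : Fin n → ℝ} {β : ℝ} {φ : toeplitz (cocycle Θ) →L[ℂ] ℂ}

theorem kms_gen_mul (hφ : IsKMSState (dynamics (cocycle Θ) r) β φ) (p : Fin n → ℕ)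
    (b : toeplitz (cocycle Θ)) :
    φ (gen Θ p * b) = (Real.exp (-(β * weight r p)) : ℂ) * φ (b * gen Θ p) :=
  hφ.apply_eigen_mul (dynamics_gen Θ r p) b

theorem kms_star_gen_mul (hφ : IsKMSState (dynamics (cocycle Θ) r) β φ) (p : Fin n → ℕ)
    (b : toeplitz (cocycle Θ)) :
    φ (star (gen Θ p) * b) = (Real.exp (β * weight r p) : ℂ) * φ (b * star (gen Θ p)) := by
  have := hφ.apply_eigen_mul (dynamics_star_gen Θ r p) b
  rwa [mul_neg, neg_neg] at this

theorem kms_monomial_self (hφ : IsKMSState (dynamics (cocycle Θ) r) β φ) (p : Fin n → ℕ) :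
    φ (gen Θ p * star (gen Θ p)) = Real.exp (-(β * weight r p)) := by
  rw [kms_gen_mul hφ, star_gen_mul_self, hφ.isState.map_one, mul_one]

/-- The two factors have different moduli, 1 and `e^x`. -/
theorem eq_zero_of_mul_eq {z : ℂ} {x : ℝ} {c : Circle} (hx : x ≠ 0)
    (h : (c : ℂ) * z = (Real.exp x : ℂ) * z) : z = 0 := by
  by_contra hz
  have h1 := congrArg norm (mul_right_cancel₀ hz h)
  rw [Circle.norm_coe, Complex.norm_real, Real.norm_eq_abs, Real.abs_exp] at h1
  exact hx (Real.exp_eq_one_iff x |>.1 h1.symm)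

/-- The vanishing of a KMS state on `L_a L_b*` for `a`, `b` with disjoint supports, unless both
have weight `0`. -/
theorem kms_monomial_eq_zero_of_weight_ne (hβ : 0 < β)
    (hφ : IsKMSState (dynamics (cocycle Θ) r) β φ) {a b : Fin n → ℕ}
    (hab : ∀ i, a i = 0 ∨ b i = 0) (h : weight r a ≠ 0 ∨ weight r b ≠ 0) :
    φ (gen Θ a * star (gen Θ b)) = 0 := by
  have h0 : φ (star (gen Θ b) * gen Θ a)
      = ((cocycle Θ a b * (cocycle Θ b a)⁻¹ : Circle) : ℂ) * φ (gen Θ a * star (gen Θ b)) := by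
    rw [star_gen_mul_gen_of_disjoint Θ hab, map_smul, smul_eq_mul]
  rcases h with h | h
  · have h1 := kms_gen_mul hφ a (star (gen Θ b))
    refine eq_zero_of_mul_eq (x := β * weight r a) (mul_ne_zero hβ.ne' h) (h0.symm.trans ?_)
    rw [h1, ← mul_assoc, ← Complex.ofReal_mul, ← Real.exp_add]
    simp
  · exact eq_zero_of_mul_eq (mul_ne_zero hβ.ne' h) (h0.symm.trans (kms_star_gen_mul hφ b _))

/-- A nonzero value of a KMS state at `L_a L_b*` forces the commutation phases of `a` and `b` with
any `x` of weight `0` to agree. -/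
theorem kms_monomial_phase (hφ : IsKMSState (dynamics (cocycle Θ) r) β φ) {a b x : Fin n → ℕ}
    (hx : weight r x = 0)
    (hne : φ (gen Θ a * star (gen Θ b)) ≠ 0) :
    cocycle Θ x a * (cocycle Θ a x)⁻¹ = cocycle Θ x b * (cocycle Θ b x)⁻¹ := by
  have hproj := hφ.isState.apply_mul_range_projection (star_gen_mul_self Θ x)
    (by rw [kms_monomial_self hφ, hx]; simp)
  -- Invariance under conjugation by `L_x`: with weight 0, the KMS factor is 1.
  have e1 : φ (gen Θ x * (gen Θ a * star (gen Θ b) * star (gen Θ x)))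
      = φ (gen Θ a * star (gen Θ b)) := by
    rw [kms_gen_mul hφ, hx, mul_assoc _ (star (gen Θ x)), star_gen_mul_self]
    simp
  -- The projection `L_x L_x*` is invisible only at an end of a product, so `L_a` is cycled away and
  -- then back.
  have e2 : φ (gen Θ a * (gen Θ x * star (gen Θ x) * star (gen Θ b)))
      = φ (gen Θ a * star (gen Θ b)) := by
    rw [kms_gen_mul hφ, mul_assoc _ (star (gen Θ b)), (hproj _).2, ← kms_gen_mul hφ]
  have e3 : gen Θ x * (gen Θ a * star (gen Θ b) * star (gen Θ x))
      = (gen Θ x * gen Θ a) * star (gen Θ x * gen Θ b) := by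
    rw [star_mul]; noncomm_ring
  rw [e3, gen_mul_comm Θ x a, gen_mul_comm Θ x b, star_smul, smul_mul_smul_comm, map_smul,
    star_mul] at e1
  have e4 : gen Θ a * gen Θ x * (star (gen Θ x) * star (gen Θ b))
      = gen Θ a * (gen Θ x * star (gen Θ x) * star (gen Θ b)) := by noncomm_ring
  rw [e4, e2, smul_eq_mul] at e1
  have e5 := mul_right_cancel₀ hne (e1.trans (one_mul _).symm)
  rw [Complex.star_def, ← Circle.coe_inv_eq_conj, ← Circle.coe_mul, Circle.coe_eq_one] at e5
  exact mul_inv_eq_one.1 e5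

/-- For antisymmetric `Θ`, a trivial commutation phase means an integral pairing. -/
theorem exists_int_of_phase_eq (hΘ : Θᵀ = -Θ) {a b x : Fin n → ℕ}
    (h : cocycle Θ x a * (cocycle Θ a x)⁻¹ = cocycle Θ x b * (cocycle Θ b x)⁻¹) :
    ∃ m : ℤ, (fun i => (a i : ℝ) - b i) ⬝ᵥ (Θ *ᵥ fun j => (x j : ℝ)) = m := by
  have anti : ∀ u v : Fin n → ℝ, u ⬝ᵥ (Θ *ᵥ v) = -(v ⬝ᵥ (Θ *ᵥ u)) := by
    intro u v
    rw [Matrix.dotProduct_mulVec, ← Matrix.mulVec_transpose, hΘ, Matrix.neg_mulVec,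
      neg_dotProduct, dotProduct_comm]
  simp only [cocycle, ← Circle.exp_neg, ← Circle.exp_add] at h
  obtain ⟨m, hm⟩ := Circle.exp_eq_exp.1 h
  refine ⟨m, ?_⟩
  have hsub : (fun i => (a i : ℝ) - b i) = (fun i => (a i : ℝ)) - fun i => (b i : ℝ) := rfl
  rw [hsub, sub_dotProduct]
  -- By antisymmetry the two halves of each commutation phase add up, turning `π` into the full
  -- period `2π`.
  rw [anti (fun i => (x i : ℝ)) (fun i => (a i : ℝ)),
    anti (fun i => (x i : ℝ)) (fun i => (b i : ℝ))] at hm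
  have hpi := Real.pi_ne_zero
  have : (2 * Real.pi) * ((fun i => (a i : ℝ)) ⬝ᵥ (Θ *ᵥ fun j => (x j : ℝ))
      - (fun i => (b i : ℝ)) ⬝ᵥ (Θ *ᵥ fun j => (x j : ℝ))) = (2 * Real.pi) * m := by
    linarith
  exact mul_left_cancel₀ (by positivity) this

end Relations

/-! ### Nondegeneracy of the corner and the values on monomials -/

section Corner

variable {k d : ℕ} {Θ : Matrix (Fin (k + d)) (Fin (k + d)) ℝ} {r : Fin (k + d) → ℝ} {β : ℝ}
  {φ : toeplitz (cocycle Θ) →L[ℂ] ℂ}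

/-- A nonzero value forces both weights to vanish, so `a` and `b` live on the last `d` coordinates.
If all weights are positive, both are 0; otherwise testing phases against the basis vectors of these
directions puts `a - b` in the kernel excluded by nondegeneracy. -/
theorem kms_monomial_eq_zero_of_disjoint (hΘ : Θᵀ = -Θ)
    (hr_pos : ∀ i : Fin k, 0 < r (Fin.castAdd d i)) (hr_zero : ∀ j : Fin d, r (Fin.natAdd k j) = 0)
    (h : (∀ i, 0 < r i) ∨ Nondegenerate (Θ.submatrix (Fin.natAdd k) (Fin.natAdd k)))
    (hβ : 0 < β) (hφ : IsKMSState (dynamics (cocycle Θ) r) β φ) {a b : Fin (k + d) → ℕ}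
    (hab : ∀ i, a i = 0 ∨ b i = 0) (hne : a ≠ b) : φ (gen Θ a * star (gen Θ b)) = 0 := by
  have hr : ∀ i, 0 ≤ r i := fun i =>
    Fin.addCases (fun i => (hr_pos i).le) (fun j => (hr_zero j).ge) i
  by_contra hφne
  have hw : weight r a = 0 ∧ weight r b = 0 := by
    by_contra hw
    exact hφne (kms_monomial_eq_zero_of_weight_ne hβ hφ hab (by tauto))
  have ha : ∀ i, 0 < r i → a i = 0 := fun i => eq_zero_of_weight_eq_zero hr hw.1
  have hb : ∀ i, 0 < r i → b i = 0 := fun i => eq_zero_of_weight_eq_zero hr hw.2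
  rcases h with h | h
  · exact hne (funext fun i => by rw [ha i (h i), hb i (h i)])
  · have hcol : ∀ j : Fin d, ∃ m : ℤ,
        ∑ i : Fin d, ((a (Fin.natAdd k i) : ℝ) - b (Fin.natAdd k i)) *
          Θ (Fin.natAdd k i) (Fin.natAdd k j) = m := by
      intro j
      have hx : weight r (Pi.single (Fin.natAdd k j) 1) = 0 := by
        simp [weight, dotProduct, Pi.single_apply, hr_zero]
      obtain ⟨m, hm⟩ := exists_int_of_phase_eq hΘ (kms_monomial_phase hφ hx hφne)
      refine ⟨m, ?_⟩
      rw [← hm]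
      simp [dotProduct, Matrix.mulVec, Fin.sum_univ_add, Pi.single_apply, ha _ (hr_pos _),
        hb _ (hr_pos _)]
    choose m hm using hcol
    have h0 := h (fun i => (a (Fin.natAdd k i) : ℤ) - b (Fin.natAdd k i)) fun y =>
      -- Integrality on basis vectors suffices, since the pairing is linear in `y`.
      ⟨∑ j, m j * y j, by
        push_cast
        simp only [← hm, dotProduct, Matrix.mulVec, Matrix.submatrix_apply, Finset.mul_sum,
          Finset.sum_mul]
        rw [Finset.sum_comm]
        simp only [mul_assoc]⟩
    refine hne (funext fun i => ?_)
    refine Fin.addCases (fun i => ?_) (fun j => ?_) i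
    · rw [ha _ (hr_pos i), hb _ (hr_pos i)]
    · have := congrFun h0 j
      simp only [Pi.zero_apply] at this
      omega

/-- The values of a KMS state on the spanning monomials. -/
theorem kms_monomial (hΘ : Θᵀ = -Θ)
    (hr_pos : ∀ i : Fin k, 0 < r (Fin.castAdd d i)) (hr_zero : ∀ j : Fin d, r (Fin.natAdd k j) = 0)
    (h : (∀ i, 0 < r i) ∨ Nondegenerate (Θ.submatrix (Fin.natAdd k) (Fin.natAdd k)))
    (hβ : 0 < β) (hφ : IsKMSState (dynamics (cocycle Θ) r) β φ) (p q : Fin (k + d) → ℕ) :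
    φ (gen Θ p * star (gen Θ q)) = if p = q then (Real.exp (-(β * weight r p)) : ℂ) else 0 := by
  split_ifs with hpq
  · rw [← hpq, kms_monomial_self hφ]
  · obtain ⟨c, hc⟩ := star_gen_mul_gen Θ p q
    have hne : p - q ≠ q - p := by
      intro e
      refine hpq (funext fun i => ?_)
      have := congrFun e i
      simp only [Pi.sub_apply] at this
      omega
    -- Cycle `L_p` to the right, cancel the common part, and cycle the remaining adjoint back to the
    -- right.
    rw [kms_gen_mul hφ, hc, map_smul, kms_star_gen_mul hφ,
      kms_monomial_eq_zero_of_disjoint hΘ hr_pos hr_zero h hβ hφ (disjoint_sub_sub p q) hne]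
    simp

theorem kms_unique (hΘ : Θᵀ = -Θ)
    (hr_pos : ∀ i : Fin k, 0 < r (Fin.castAdd d i)) (hr_zero : ∀ j : Fin d, r (Fin.natAdd k j) = 0)
    (h : (∀ i, 0 < r i) ∨ Nondegenerate (Θ.submatrix (Fin.natAdd k) (Fin.natAdd k)))
    (hβ : 0 < β) {ψ : toeplitz (cocycle Θ) →L[ℂ] ℂ}
    (hφ : IsKMSState (dynamics (cocycle Θ) r) β φ)
    (hψ : IsKMSState (dynamics (cocycle Θ) r) β ψ) : φ = ψ := by
  ext x
  refine mem_of_monomial_mem Θ (LinearMap.eqLocus φ.toLinearMap ψ.toLinearMap)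
    (isClosed_eq φ.continuous ψ.continuous) (fun p q => ?_) x
  exact (kms_monomial hΘ hr_pos hr_zero h hβ hφ p q).trans
    (kms_monomial hΘ hr_pos hr_zero h hβ hψ p q).symm

end Corner

/-! ### Gibbs functionals -/

/-- The sum is a product of `n` geometric series: any finite set of indices lies in a box, over
which the partial sum factorizes. -/
theorem summable_exp_neg_weight {r : Fin n → ℝ} (hr : ∀ i, 0 < r i) {β : ℝ} (hβ : 0 < β) :
    Summable fun q : Fin n → ℕ => Real.exp (-(β * weight r q)) := by
  have hprod : ∀ q : Fin n → ℕ, Real.exp (-(β * weight r q))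
      = ∏ i, Real.exp (-(β * r i)) ^ q i := by
    intro q
    rw [weight, dotProduct, Finset.mul_sum, ← Finset.sum_neg_distrib, Real.exp_sum]
    refine Finset.prod_congr rfl fun i _ => ?_
    rw [← Real.exp_nat_mul]
    congr 1
    ring
  have hx : ∀ i, Real.exp (-(β * r i)) < 1 := fun i =>
    Real.exp_lt_one_iff.2 (neg_lt_zero.2 (mul_pos hβ (hr i)))
  refine summable_of_sum_le (c := ∏ i, (1 - Real.exp (-(β * r i)))⁻¹)
    (fun q => (Real.exp_pos _).le) fun u => ?_
  classical
  obtain ⟨N, hN⟩ : ∃ N, ∀ q ∈ u, ∀ i, q i < N := by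
    refine ⟨u.sup (fun q => Finset.univ.sup q) + 1, fun q hq i => Nat.lt_succ_of_le ?_⟩
    exact (Finset.le_sup (f := q) (Finset.mem_univ i)).trans
      (Finset.le_sup (f := fun q : Fin n → ℕ => Finset.univ.sup q) hq)
  calc ∑ q ∈ u, Real.exp (-(β * weight r q))
      ≤ ∑ q ∈ Fintype.piFinset fun _ : Fin n => Finset.range N, Real.exp (-(β * weight r q)) :=
        Finset.sum_le_sum_of_subset_of_nonneg
          (fun q hq => Fintype.mem_piFinset.2 fun i => Finset.mem_range.2 (hN q hq i))
          fun _ _ _ => (Real.exp_pos _).le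
    _ = ∏ i, ∑ j ∈ Finset.range N, Real.exp (-(β * r i)) ^ j := by
        rw [Finset.prod_univ_sum]
        exact Finset.sum_congr rfl fun q _ => hprod q
    _ ≤ ∏ i, (1 - Real.exp (-(β * r i)))⁻¹ := by
        refine Finset.prod_le_prod
          (fun i _ => Finset.sum_nonneg fun j _ => pow_nonneg (Real.exp_pos _).le j) fun i _ => ?_
        rw [← tsum_geometric_of_lt_one (Real.exp_pos _).le (hx i)]
        exact (summable_geometric_of_lt_one (Real.exp_pos _).le (hx i)).sum_le_tsum _
          fun j _ => pow_nonneg (Real.exp_pos _).le j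

/-- A convex combination of functionals of norm at most `1`. -/
theorem exists_convex_combination {E ι : Type*} [NormedAddCommGroup E] [NormedSpace ℂ E]
    {v : ι → E →L[ℂ] ℂ} (hv : ∀ i, ‖v i‖ ≤ 1) {w : ι → ℝ} (hw0 : ∀ i, 0 ≤ w i)
    (hw1 : HasSum w 1) :
    ∃ φ : E →L[ℂ] ℂ, ‖φ‖ ≤ 1 ∧ ∀ x, HasSum (fun i => (w i : ℂ) * v i x) (φ x) := by
  have hle : ∀ i, ‖(w i : ℂ) • v i‖ ≤ w i := by
    intro i
    rw [norm_smul, Complex.norm_real, Real.norm_of_nonneg (hw0 i)]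
    exact mul_le_of_le_one_right (hw0 i) (hv i)
  have hsummable : Summable fun i => (w i : ℂ) • v i :=
    Summable.of_norm_bounded hw1.summable hle
  exact ⟨∑' i, (w i : ℂ) • v i, tsum_of_norm_bounded hw1 hle,
    fun x => hsummable.hasSum.mapL (ContinuousLinearMap.apply ℂ ℂ x)⟩

/-- The vector state `X ↦ ⟨δ_q, X δ_q⟩`. -/
def vectorState (q : Fin n → ℕ) : (Hil n →L[ℂ] Hil n) →L[ℂ] ℂ :=
  (innerSL ℂ (delta q)).comp (ContinuousLinearMap.apply ℂ (Hil n) (delta q))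

theorem vectorState_apply (q : Fin n → ℕ) (X : Hil n →L[ℂ] Hil n) :
    vectorState q X = inner ℂ (delta q) (X (delta q)) := rfl

theorem norm_vectorState_le (q : Fin n → ℕ) : ‖(vectorState q)‖ ≤ 1 := by
  refine ContinuousLinearMap.opNorm_le_bound _ zero_le_one fun X => ?_
  rw [vectorState_apply, one_mul]
  refine (norm_inner_le_norm _ _).trans ?_
  rw [norm_delta, one_mul]
  simpa [norm_delta] using X.le_opNorm (delta q)

/-- A normalized positive functional on `B(ℓ²(ℕⁿ))` that satisfies the algebraic KMS relations
with respect to the isometries `L_p` and is invariant under diagonal unitaries. -/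
structure IsEquilibrium (σ : (Fin n → ℕ) → (Fin n → ℕ) → Circle) (r : Fin n → ℝ) (β : ℝ)
    (φ : (Hil n →L[ℂ] Hil n) →L[ℂ] ℂ) : Prop where
  norm_le : ‖φ‖ ≤ 1
  map_one : φ 1 = 1
  nonneg : ∀ X, 0 ≤ φ (star X * X)
  invariant : ∀ s t X, φ (conjGroup s t X) = φ X
  leftReg_mul : ∀ p X, φ (leftReg σ p * X)
    = (Real.exp (-(β * weight r p)) : ℂ) * φ (X * leftReg σ p)
  mul_star_leftReg : ∀ p X, φ (X * star (leftReg σ p))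
    = (Real.exp (-(β * weight r p)) : ℂ) * φ (star (leftReg σ p) * X)

/-- The Gibbs functional, averaging the vector states at `δ_q` with weights proportional to
`e^{-β⟨q,r⟩}`. The relations for `L_p` come from reindexing `q = p + s`: the weights are
multiplicative, and indices not above `p` contribute 0 since `L_p* δ_q = 0`. -/
theorem exists_isEquilibrium_of_pos (σ : (Fin n → ℕ) → (Fin n → ℕ) → Circle) {r : Fin n → ℝ}
    (hr : ∀ i, 0 < r i) {β : ℝ} (hβ : 0 < β) : ∃ φ, IsEquilibrium σ r β φ := by
  have hsum := summable_exp_neg_weight hr hβ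
  set Z := ∑' q : Fin n → ℕ, Real.exp (-(β * weight r q)) with hZdef
  have hZ : 0 < Z := hsum.tsum_pos (fun q => (Real.exp_pos _).le) 0 (Real.exp_pos _)
  set w : (Fin n → ℕ) → ℝ := fun q => Real.exp (-(β * weight r q)) / Z with hw
  have hw0 : ∀ q, 0 ≤ w q := fun q => div_nonneg (Real.exp_pos _).le hZ.le
  have hw1 : HasSum w 1 := by
    have := hsum.hasSum.div_const Z
    rwa [← hZdef, div_self hZ.ne'] at this
  have hwadd : ∀ p s, w (p + s) = Real.exp (-(β * weight r p)) * w s := by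
    intro p s
    simp only [hw, weight_add, mul_add, neg_add, Real.exp_add]
    ring
  obtain ⟨φ, hφ, happ'⟩ :=
    exists_convex_combination (v := vectorState (n := n)) norm_vectorState_le hw0 hw1
  have happ : ∀ X, HasSum (fun q => (w q : ℂ) * inner ℂ (delta q) (X (delta q))) (φ X) := by
    intro X
    simpa only [vectorState_apply] using happ' X
  refine ⟨φ, ⟨hφ, ?_, ?_, ?_, ?_, ?_⟩⟩
  · refine (happ 1).unique ?_
    have := hw1.mapL Complex.ofRealCLM
    convert this using 2 with q
    · simp [inner_self_eq_norm_sq_to_K, norm_delta]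
    · simp
  · intro X
    refine (happ _).nonneg fun q => ?_
    refine mul_nonneg (by exact_mod_cast hw0 q) ?_
    rw [mul_apply_eq_comp, ContinuousLinearMap.star_eq_adjoint,
      ContinuousLinearMap.adjoint_inner_right]
    rw [inner_self_eq_norm_sq_to_K]
    positivity
  · intro s t X
    refine (happ _).unique ?_
    convert happ X using 2 with q
    rw [conjGroup_apply, mul_apply_eq_comp, mul_apply_eq_comp, ContinuousLinearMap.star_eq_adjoint,
      ← ContinuousLinearMap.adjoint_inner_left, ← ContinuousLinearMap.star_eq_adjoint, star_diagOp]
    simp only [diagOp, weightedIsometry_delta, id, map_smul, inner_smul_left, inner_smul_right]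
    rw [mul_left_comm ((Circle.exp _ : Circle) : ℂ), ← mul_assoc ((starRingEnd ℂ) _), ← Complex.star_def,
      star_circle_mul_self, one_mul]
  · intro p X
    refine (happ _).unique ?_
    refine ((add_right_injective p).hasSum_iff fun q hq => ?_).1 ?_
    · have hpq : ¬ p ≤ q := fun hpq => hq ⟨q - p, add_tsub_cancel_of_le hpq⟩
      rw [mul_apply_eq_comp, ← ContinuousLinearMap.adjoint_inner_left,
        ← ContinuousLinearMap.star_eq_adjoint, star_leftReg_delta_of_not_le σ hpq,
        inner_zero_left, mul_zero]
    · refine (congrArg (HasSum · _) (funext fun s => ?_)).mpr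
        ((happ (X * leftReg σ p)).mul_left (Real.exp (-(β * weight r p)) : ℂ))
      rw [Function.comp_apply]
      rw [mul_apply_eq_comp, mul_apply_eq_comp, ← ContinuousLinearMap.adjoint_inner_left,
        ← ContinuousLinearMap.star_eq_adjoint, star_leftReg_delta_add, leftReg_delta, map_smul,
        inner_smul_left, inner_smul_right, hwadd]
      simp
      ring
  · intro p X
    refine (happ _).unique ?_
    refine ((add_right_injective p).hasSum_iff fun q hq => ?_).1 ?_
    · have hpq : ¬ p ≤ q := fun hpq => hq ⟨q - p, add_tsub_cancel_of_le hpq⟩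
      rw [mul_apply_eq_comp, star_leftReg_delta_of_not_le σ hpq, map_zero, inner_zero_right,
        mul_zero]
    · refine (congrArg (HasSum · _) (funext fun s => ?_)).mpr
        ((happ (star (leftReg σ p) * X)).mul_left (Real.exp (-(β * weight r p)) : ℂ))
      rw [Function.comp_apply]
      rw [mul_apply_eq_comp, mul_apply_eq_comp, star_leftReg_delta_add,
        ContinuousLinearMap.star_eq_adjoint, ContinuousLinearMap.adjoint_inner_right,
        leftReg_delta, map_smul, inner_smul_left, inner_smul_right, hwadd]
      simp
      ring

/-- Equilibrium functionals exist also for weights that vanish in some directions: take a weak*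
limit of Gibbs functionals. -/
theorem exists_isEquilibrium (σ : (Fin n → ℕ) → (Fin n → ℕ) → Circle) {r : Fin n → ℝ}
    (hr : ∀ i, 0 ≤ r i) {β : ℝ} (hβ : 0 < β) : ∃ φ, IsEquilibrium σ r β φ := by
  -- Strictly positive perturbations of `r`, so that each partition function converges.
  let R : ℕ → Fin n → ℝ := fun m i => r i + 1 / ((m : ℝ) + 1)
  have hR : ∀ m i, 0 < R m i := fun m i => add_pos_of_nonneg_of_pos (hr i) (by positivity)
  choose f hf using fun m => exists_isEquilibrium_of_pos σ (hR m) hβ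
  have hle : (Filter.hyperfilter ℕ : Filter ℕ) ≤ Filter.atTop := Nat.hyperfilter_le_atTop
  have hweight : ∀ p, Filter.Tendsto (fun m => (Real.exp (-(β * weight (R m) p)) : ℂ))
      (Filter.hyperfilter ℕ) (nhds (Real.exp (-(β * weight r p)) : ℂ)) := by
    intro p
    have h1 : Filter.Tendsto R Filter.atTop (nhds r) := by
      refine tendsto_pi_nhds.2 fun i => ?_
      simpa [R] using tendsto_one_div_add_atTop_nhds_zero_nat.const_add (r i)
    have h2 : Continuous fun s : Fin n → ℝ => (Real.exp (-(β * weight s p)) : ℂ) := by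
      unfold weight dotProduct
      fun_prop
    exact ((h2.tendsto r).comp h1).mono_left hle
  -- Banach–Alaoglu along a free ultrafilter, which replaces a convergent subnet.
  let F : ℕ → WeakDual ℂ (Hil n →L[ℂ] Hil n) := fun m => WeakDual.toStrongDual.symm (f m)
  obtain ⟨ψ, hψ, hlim⟩ := (WeakDual.isCompact_closedBall (0 : StrongDual ℂ (Hil n →L[ℂ] Hil n))
    1).ultrafilter_le_nhds ((Filter.hyperfilter ℕ).map F) (by
      rw [Filter.le_principal_iff]
      refine Filter.Eventually.of_forall (p := fun m => F m ∈ _) fun m => ?_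
      simpa [F] using (hf m).norm_le)
  have hev : ∀ X, Filter.Tendsto (fun m => f m X) (Filter.hyperfilter ℕ)
      (nhds (WeakDual.toStrongDual ψ X)) := fun X =>
    ((WeakDual.eval_continuous X).tendsto ψ).comp hlim
  refine ⟨WeakDual.toStrongDual ψ, ⟨?_, ?_, ?_, ?_, ?_, ?_⟩⟩
  · simpa using hψ
  · refine tendsto_nhds_unique (hev 1) ?_
    simp only [(hf _).map_one]
    exact tendsto_const_nhds
  · exact fun X => ge_of_tendsto' (hev _) fun m => (hf m).nonneg X
  -- Each approximant is invariant for every weight vector `s`, not only for its own `R m`, so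
  -- invariance passes to the limit.
  · intro s t X
    refine tendsto_nhds_unique (hev _) ?_
    simp only [(hf _).invariant]
    exact hev X
  · intro p X
    refine tendsto_nhds_unique (hev _) ?_
    simp only [(hf _).leftReg_mul]
    exact (hweight p).mul (hev _)
  · intro p X
    refine tendsto_nhds_unique (hev _) ?_
    simp only [(hf _).mul_star_leftReg]
    exact (hweight p).mul (hev _)

/-! ### Existence -/

theorem IsEquilibrium.mul_monomial {Θ : Matrix (Fin n) (Fin n) ℝ} {r : Fin n → ℝ} {β : ℝ}
    {ψ : (Hil n →L[ℂ] Hil n) →L[ℂ] ℂ} (hψ : IsEquilibrium (cocycle Θ) r β ψ) (p q : Fin n → ℕ)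
    (X : Hil n →L[ℂ] Hil n) :
    ψ (X * (leftReg (cocycle Θ) p * star (leftReg (cocycle Θ) q)))
      = (Real.exp (β * (weight r p - weight r q)) : ℂ) *
        ψ (leftReg (cocycle Θ) p * star (leftReg (cocycle Θ) q) * X) := by
  rw [← mul_assoc, hψ.mul_star_leftReg, mul_assoc (leftReg _ p), hψ.leftReg_mul, ← mul_assoc,
    ← mul_assoc, ← Complex.ofReal_mul, ← Real.exp_add]
  congr 3
  ring_nf

/-- The density argument is applied to `b`, with `a` and `F` fixed, because `F (iβ)` need not depend
continuously on `a`. For a monomial `b`, the relation on `ψ` must be matched with the value of `φ (b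
* F z)` at `z = iβ`. -/
theorem exists_kms (Θ : Matrix (Fin n) (Fin n) ℝ) {r : Fin n → ℝ}
    (hr : ∀ i, 0 ≤ r i) {β : ℝ} (hβ : 0 < β) :
    ∃ φ, IsKMSState (dynamics (cocycle Θ) r) β φ := by
  obtain ⟨ψ, hψ⟩ := exists_isEquilibrium (cocycle Θ) hr hβ
  let φ : toeplitz (cocycle Θ) →L[ℂ] ℂ :=
    ⟨ψ.toLinearMap ∘ₗ (toeplitz (cocycle Θ)).subtype.toLinearMap,
      ψ.continuous.comp continuous_subtype_val⟩
  have hφ : ∀ x : toeplitz (cocycle Θ), φ x = ψ x := fun _ => rfl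
  refine ⟨φ, ⟨fun a => hψ.nonneg a, hψ.map_one⟩, fun a b F hF => ?_⟩
  refine mem_of_monomial_mem Θ
    (LinearMap.eqLocus (φ.toLinearMap ∘ₗ LinearMap.mulLeft ℂ a)
      (φ.toLinearMap ∘ₗ LinearMap.mulRight ℂ (F (Complex.I * β))))
    (isClosed_eq (φ.continuous.comp (continuous_const_mul a))
      (φ.continuous.comp (continuous_mul_const _))) (fun p q => ?_) b
  change φ (a * _) = φ (_ * F (Complex.I * β))
  set b' := gen Θ p * star (gen Θ q) with hb'
  set l : ℝ := weight r p - weight r q with hl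
  have h1 : φ (a * b') = (Real.exp (β * l) : ℂ) * φ (b' * a) := hψ.mul_monomial p q a
  have hinv : ∀ (t : ℝ) (x : toeplitz (cocycle Θ)),
      φ (dynamics (cocycle Θ) r (Multiplicative.ofAdd t) x) = φ x := fun t x =>
    hψ.invariant r (Multiplicative.ofAdd t) x
  -- By invariance, evolving `a` by `t` amounts to evolving the eigenvector `b'` by `-t`.
  have hreal : ∀ t : ℝ, φ (b' * F t) = Complex.exp (-(l * t * Complex.I)) * φ (b' * a) := by
    intro t
    have h2 := hinv t (b' * a)
    rw [map_mul, ← hF.apply_real, hb', dynamics_monomial, ← hb', smul_mul_assoc, map_smul,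
      smul_eq_mul] at h2
    rw [← h2, ← mul_assoc, ← Complex.exp_add, neg_add_cancel, Complex.exp_zero, one_mul]
  have hd1 : Differentiable ℂ fun z => φ (b' * F z) :=
    φ.differentiable.comp (hF.differentiable.const_mul b')
  have hd2 : Differentiable ℂ fun z : ℂ => Complex.exp (-(l * z * Complex.I)) * φ (b' * a) := by
    fun_prop
  -- Both sides are entire and agree on the real line, which accumulates at 0; hence they agree at
  -- `iβ`.
  have hfreq : ∃ᶠ z in nhdsWithin (0 : ℂ) {0}ᶜ,
      φ (b' * F z) = Complex.exp (-(l * z * Complex.I)) * φ (b' * a) := by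
    have ht : Filter.Tendsto (fun t : ℝ => (t : ℂ)) (nhdsWithin 0 {0}ᶜ) (nhdsWithin 0 {0}ᶜ) := by
      refine Filter.Tendsto.inf ?_ ?_
      · simpa using Complex.continuous_ofReal.tendsto 0
      · simp
    exact ht.frequently (Filter.Eventually.of_forall hreal).frequently
  have heq := congrFun (AnalyticOnNhd.eq_of_frequently_eq
    (fun z _ => hd1.analyticAt z) (fun z _ => hd2.analyticAt z) hfreq) (Complex.I * β)
  rw [h1, heq]
  congr 1
  rw [Complex.ofReal_exp]
  congr 1
  push_cast
  linear_combination (l * β : ℂ) * Complex.I_sq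

end ToeplitzTorus

end

theorem mainTheorem12 (k d : ℕ) (Θ : Matrix (Fin (k + d)) (Fin (k + d)) ℝ) (hΘ : Θᵀ = -Θ)
    (r : Fin (k + d) → ℝ) (hr_pos : ∀ i : Fin k, 0 < r (Fin.castAdd d i))
    (hr_zero : ∀ j : Fin d, r (Fin.natAdd k j) = 0)
    (h : (∀ i, 0 < r i) ∨
      ToeplitzTorus.Nondegenerate (Θ.submatrix (Fin.natAdd k) (Fin.natAdd k)))
    (β : ℝ) (hβ : 0 < β) :
    ∃! φ : ToeplitzTorus.toeplitz (ToeplitzTorus.cocycle Θ) →L[ℂ] ℂ,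
      ToeplitzTorus.IsKMSState
        (ToeplitzTorus.dynamics (ToeplitzTorus.cocycle Θ) r) β φ := by
  obtain ⟨φ, hφ⟩ := ToeplitzTorus.exists_kms Θ
    (fun i => Fin.addCases (fun i => (hr_pos i).le) (fun j => (hr_zero j).ge) i) hβ
  exact ⟨φ, hφ, fun ψ hψ => ToeplitzTorus.kms_unique hΘ hr_pos hr_zero h hβ hψ hφ⟩
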